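/- Let $n\ge 0$, let $p,\varepsilon\in(0,1)$ with $p\ne\tfrac12$, and let $\mu_p^n=(p\,\delta_1+(1-p)\,\delta_0)^{\otimes n}$ be the $p$-biased measure on $\{0,1\}^n$. For $S\subseteq[n]$ put $\chi_S^p(x)=\prod_{i\in S}\frac{x_i-p}{\sqrt{p(1-p)}}$. For $f:\{0,1\}^n\to\{-1,1\}$ let $\hat f(S)=\mathbb{E}_{x\sim\mu_p^n}[f(x)\chi_S^p(x)]$ and $$\mathrm{Ent}_p(f)=\sum_{S\subseteq[n]}\hat f(S)^2\log\frac{1}{\hat f(S)^2},$$ with natural logarithms and the convention $0\log\frac10=0$. Let $X\sim\mu_p^n$, let $Y$ be obtained from $X$ by independently resampling each coordinate from $\mu_p$ with probability $\varepsilon$, and let $$S_\varepsilon(f)=\mathrm{Cov}(f(X),f(Y))=\mathbb{E}[f(X)f(Y)]-\big(\mathbb{E}_{\mu_p^n}f\big)^2$$ be the noise stability of $f$. Let $$B(p)=\frac{\frac{1-p}{p}-\frac{p}{1-p}}{2\big(\log(1-p)-\log p\big)},\qquad \alpha(p,\varepsilon)=\frac{1}{\varepsilon+\log(2e\,B(p))+3\log\log(2e\,B(p))}$$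 be the $p$-biased hypercontractive constant and the Keller–Kindler exponent. Then, for every $f:\{0,1\}^n\to\{-1,1\}$, $$S_\varepsilon(f)\le(6e+1)\left(\frac{\mathrm{Ent}_p(f)}{(2p-1)^2}\right)^{\alpha(p,\varepsilon)\,\varepsilon}.$$ -/

import Mathlib

/-- The `p`-biased product measure `μ_p^n` on the cube `{0,1}^n = (Fin n → Bool)`: the mass of the
point `x` is `p ^ |x| * (1 - p) ^ (n - |x|)`. -/
noncomputable def biasedMass {n : ℕ} (p : ℝ) (x : Fin n → Bool) : ℝ :=
  ∏ i, if x i then p else 1 - p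

/-- Expectation of `g` with respect to `μ_p^n`. -/
noncomputable def biasedExp {n : ℕ} (p : ℝ) (g : (Fin n → Bool) → ℝ) : ℝ :=
  ∑ x, biasedMass p x * g x

/-- The `p`-biased character `χ_S^p(x) = ∏_{i ∈ S} (x_i - p) / √(p(1-p))`. -/
noncomputable def biasedChar {n : ℕ} (p : ℝ) (S : Finset (Fin n)) (x : Fin n → Bool) : ℝ :=
  ∏ i ∈ S, ((if x i then 1 else 0) - p) / Real.sqrt (p * (1 - p))

/-- The `p`-biased Fourier coefficient of `f` at `S`. -/
noncomputable def biasedFourier {n : ℕ} (p : ℝ) (f : (Fin n → Bool) → ℝ)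
    (S : Finset (Fin n)) : ℝ :=
  biasedExp p (fun x => f x * biasedChar p S x)

/-- The spectral entropy of `f` with respect to `μ_p^n` (natural logarithm; a vanishing
coefficient contributes `0`). -/
noncomputable def spectralEntropy {n : ℕ} (p : ℝ) (f : (Fin n → Bool) → ℝ) : ℝ :=
  ∑ S : Finset (Fin n), biasedFourier p f S ^ 2 * Real.log (1 / biasedFourier p f S ^ 2)

/-- `E[f(X) f(Y)]`, where `X ∼ μ_p^n` and `Y` is obtained from `X` by independently resampling
each coordinate with probability `ε`: the coordinates `i` with `r i = true`, where `r ∼ μ_ε^n`,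
are replaced by those of a fresh `z ∼ μ_p^n`. -/
noncomputable def noiseCorrelation {n : ℕ} (p ε : ℝ) (f : (Fin n → Bool) → ℝ) : ℝ :=
  biasedExp p fun x => biasedExp ε fun r => biasedExp p fun z =>
    f x * f (fun i => if r i then z i else x i)

/-- The noise stability `S_ε(f) = Cov(f(X), f(Y)) = E[f(X) f(Y)] - E[f(X)] E[f(Y)]`; both `X` and
`Y` have law `μ_p^n`. -/
noncomputable def noiseStability {n : ℕ} (p ε : ℝ) (f : (Fin n → Bool) → ℝ) : ℝ :=
  noiseCorrelation p ε f - biasedExp p f * biasedExp p f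

/-- The `p`-biased hypercontractive constant
`B(p) = ((1-p)/p - p/(1-p)) / (2 (log (1-p) - log p))`, for `p ≠ 1/2`. -/
noncomputable def hyperconst (p : ℝ) : ℝ :=
  ((1 - p) / p - p / (1 - p)) / (2 * (Real.log (1 - p) - Real.log p))

/-- The exponent
`α(p, ε) = 1 / (ε + log (2 e B(p)) + 3 log log (2 e B(p)))` of Keller and Kindler. -/
noncomputable def kellerKindlerExponent (p ε : ℝ) : ℝ :=
  1 / (ε + Real.log (2 * Real.exp 1 * hyperconst p)
    + 3 * Real.log (Real.log (2 * Real.exp 1 * hyperconst p)))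

open Real

/-! Write `w` for the entropy divided by `(2p-1)^2`, and `D_i f` for the discrete derivative. The
bias turns influences into spectral data: where `f` depends on coordinate `i`, its average over that
coordinate is `±(2p-1)`, with the same sign pattern as `D_i f`. So `(2p-1) E|D_i f|` is the inner
product of the average with `D_i f`, which by Plancherel is the edge correlation `∑_{S ∌ i} f̂(S)
f̂(S ∪ {i})`. A chain-rule induction on entropy (`exists_edge_bound`) bounds the sum of the squared
edge correlations by half the entropy, hence `∑ (E|D_i f|)^2 ≤ w/2`.

It remains to see that small `L¹` influences force small noise stability (Keller–Kindler).
Kearns–Saul gives biased hypercontractivity from `L^{1/(1-κ)}` to `L²` at squared correlation `κ /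
B(p)`. Applied to slightly smoothed derivatives and combined with interpolation between `L¹` and
`L²`, it yields stability at most `w^{1-2κ}` at correlation `r = (3/4) κ / B(p)`
(`low_noise_sum_le`). Hölder over the spectrum passes from `r` to `1-ε ≤ r^θ`, and `κ = 1/(2L^2)`
with `L = log (2eB)` gives the exponent (`exponent_bound`). -/

theorem sum_mul_rpow_mul_rpow_le {ι : Type*} (s : Finset ι) (w a b : ι → ℝ)
    (hw : ∀ i ∈ s, 0 ≤ w i) (ha : ∀ i ∈ s, 0 ≤ a i) (hb : ∀ i ∈ s, 0 ≤ b i)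
    {θ : ℝ} (h0 : 0 < θ) (h1 : θ < 1) :
    ∑ i ∈ s, w i * (a i ^ (1 - θ) * b i ^ θ) ≤
      (∑ i ∈ s, w i * a i) ^ (1 - θ) * (∑ i ∈ s, w i * b i) ^ θ := by
  have h1' : 0 < 1 - θ := by linarith
  have hpq : ((1 - θ)⁻¹).HolderConjugate θ⁻¹ := by
    constructor
    · simp
    · positivity
    · positivity
  have h := Real.inner_le_Lp_mul_Lq_of_nonneg s hpq
    (f := fun i => (w i * a i) ^ (1 - θ)) (g := fun i => (w i * b i) ^ θ)
    (fun i hi => rpow_nonneg (mul_nonneg (hw i hi) (ha i hi)) _)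
    (fun i hi => rpow_nonneg (mul_nonneg (hw i hi) (hb i hi)) _)
  simp only [one_div, inv_inv] at h
  convert h using 1
  · refine Finset.sum_congr rfl fun i hi => ?_
    rw [mul_rpow (hw i hi) (ha i hi), mul_rpow (hw i hi) (hb i hi)]
    have : w i ^ (1 - θ) * w i ^ θ = w i := by
      rw [← rpow_add' (hw i hi) (by simp)]; simp
    calc _ = (w i ^ (1 - θ) * w i ^ θ) * (a i ^ (1 - θ) * b i ^ θ) := by rw [this]
      _ = _ := by ring
  · congr 2
    · refine Finset.sum_congr rfl fun i hi => ?_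
      rw [rpow_rpow_inv (mul_nonneg (hw i hi) (ha i hi)) h1'.ne']
    · refine Finset.sum_congr rfl fun i hi => ?_
      rw [rpow_rpow_inv (mul_nonneg (hw i hi) (hb i hi)) h0.ne']

/-! ### Kearns–Saul and the two-point moment bound. -/

/-- This is the concavity of `log (cosh √s)` in disguise: its derivative at `s = x^2` is `tanh x /
(2x)`. The sign comes from `x ≤ sinh x ≤ sinh x * cosh x`. -/
theorem antitoneOn_tanh_div : AntitoneOn (fun x : ℝ => sinh x / cosh x / x) (Set.Ioi 0) := by
  have hd : ∀ x ∈ Set.Ioi (0 : ℝ), HasDerivAt (fun x : ℝ => sinh x / cosh x / x)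
      (((cosh x * cosh x - sinh x * sinh x) / cosh x ^ 2 * x - sinh x / cosh x * 1) / x ^ 2) x :=
    fun x hx => ((hasDerivAt_sinh x).div (hasDerivAt_cosh x) (cosh_pos x).ne').div
      (hasDerivAt_id x) (ne_of_gt hx)
  refine antitoneOn_of_deriv_nonpos (convex_Ioi 0)
    (fun x hx => (hd x hx).continuousAt.continuousWithinAt)
    (fun x hx => (hd x (by simpa using hx)).differentiableAt.differentiableWithinAt) ?_
  intro x hx
  have hx : 0 < x := by simpa using hx
  rw [(hd x hx).deriv]
  apply div_nonpos_of_nonpos_of_nonneg _ (by positivity)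
  have hc := cosh_pos x
  have h1 : cosh x * cosh x - sinh x * sinh x = 1 := by nlinarith [cosh_sq x]
  have h2 : x ≤ sinh x := self_le_sinh_iff.2 hx.le
  have h3 := one_le_cosh x
  rw [h1, show 1 / cosh x ^ 2 * x - sinh x / cosh x * 1 = (x - sinh x * cosh x) / cosh x ^ 2 by
    field_simp]
  apply div_nonpos_of_nonpos_of_nonneg _ (by positivity)
  nlinarith

/-- `log cosh √s` is concave in `s`: the tangent bound at `s = v ^ 2`, for `m, v ≥ 0`. -/
theorem log_cosh_le_of_nonneg {m v : ℝ} (hm : 0 ≤ m) (hv : 0 < v) :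
    log (cosh m) ≤ log (cosh v) + sinh v / cosh v / v / 2 * (m ^ 2 - v ^ 2) := by
  set k := sinh v / cosh v / v with hk
  have hd : ∀ x : ℝ, HasDerivAt (fun x : ℝ => k / 2 * x ^ 2 - log (cosh x))
      (k / 2 * (2 * x) - sinh x / cosh x) x := fun x => by
    have h := ((hasDerivAt_pow 2 x).const_mul (k / 2)).sub
      ((hasDerivAt_cosh x).log (cosh_pos x).ne')
    have e : k / 2 * (2 * x) - sinh x / cosh x =
        k / 2 * ((2 : ℕ) * x ^ (2 - 1)) - sinh x / cosh x := by simp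
    rw [e]
    exact h
  suffices h : k / 2 * v ^ 2 - log (cosh v) ≤ k / 2 * m ^ 2 - log (cosh m) by linarith
  have hdiff : Differentiable ℝ fun x : ℝ => k / 2 * x ^ 2 - log (cosh x) :=
    fun x => (hd x).differentiableAt
  rcases le_total m v with hmv | hmv
  · refine antitoneOn_of_deriv_nonpos (convex_Icc 0 v) hdiff.continuous.continuousOn
      hdiff.differentiableOn ?_ ⟨hm, hmv⟩ ⟨hv.le, le_rfl⟩ hmv
    intro x hx
    rw [interior_Icc] at hx
    rw [(hd x).deriv]
    have h := antitoneOn_tanh_div (a := x) (b := v) hx.1 hv hx.2.le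
    simp only [← hk] at h
    rw [le_div_iff₀ hx.1] at h
    linarith
  · refine monotoneOn_of_deriv_nonneg (convex_Ici v) hdiff.continuous.continuousOn
      hdiff.differentiableOn ?_ (Set.mem_Ici.2 le_rfl) hmv hmv
    intro x hx
    rw [interior_Ici] at hx
    have hx0 : 0 < x := hv.trans hx
    rw [(hd x).deriv]
    have h := antitoneOn_tanh_div (a := v) (b := x) hv hx0 (le_of_lt hx)
    simp only [← hk] at h
    rw [div_le_iff₀ hx0] at h
    linarith

theorem log_cosh_le (m : ℝ) {v : ℝ} (hv : v ≠ 0) :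
    log (cosh m) ≤ log (cosh v) + sinh v / cosh v / v / 2 * (m ^ 2 - v ^ 2) := by
  have h := log_cosh_le_of_nonneg (abs_nonneg m) (abs_pos.2 hv)
  rw [cosh_abs, cosh_abs, sq_abs, sq_abs] at h
  rcases abs_cases v with ⟨hv', -⟩ | ⟨hv', -⟩
  · rwa [hv'] at h
  · rw [hv', sinh_neg, neg_div, neg_div_neg_eq] at h
    exact h

theorem bias_eq_exp {p : ℝ} (hp : p ∈ Set.Ioo (0 : ℝ) 1) {v : ℝ}
    (hv : v = (log (1 - p) - log p) / 2) :
    p = exp (-v) / (2 * cosh v) ∧ 1 - p = exp v / (2 * cosh v) := by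
  have h1 : exp (2 * v) = (1 - p) / p := by
    rw [hv, mul_div_cancel₀ _ two_ne_zero, exp_sub, exp_log (by linarith [hp.2]), exp_log hp.1]
  have hvv : exp v * exp v = (1 - p) / p := by rw [← h1, ← exp_add]; congr 1; ring
  have hvn : exp v * exp (-v) = 1 := by rw [← exp_add]; simp
  have hc : 2 * cosh v = exp v + exp (-v) := by rw [cosh_eq]; ring
  have h0 := exp_pos v
  have h2 : p * exp v = (1 - p) * exp (-v) := by
    have : p * (exp v * exp v) = 1 - p := by
      rw [hvv, mul_div_cancel₀ _ hp.1.ne']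
    calc p * exp v = p * exp v * (exp v * exp (-v)) := by rw [hvn, mul_one]
      _ = p * (exp v * exp v) * exp (-v) := by ring
      _ = _ := by rw [this]
  have h3 : 0 < exp v + exp (-v) := by positivity
  rw [hc, eq_div_iff h3.ne', eq_div_iff h3.ne']
  constructor <;> linarith

theorem hyperconst_eq {p : ℝ} (hp : p ∈ Set.Ioo (0 : ℝ) 1) :
    hyperconst p = (1 - 2 * p) / (p * (1 - p)) / (2 * (log (1 - p) - log p)) := by
  have h1 := hp.1.ne'
  have h2 : 1 - p ≠ 0 := by linarith [hp.2]
  rw [hyperconst]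
  congr 1
  field_simp
  ring

theorem log_one_sub_sub_log_ne_zero {p : ℝ} (hp : p ∈ Set.Ioo (0 : ℝ) 1) (hp2 : p ≠ 1 / 2) :
    log (1 - p) - log p ≠ 0 := by
  intro h
  have := log_injOn_pos (Set.mem_Ioi.2 (by linarith [hp.2])) (Set.mem_Ioi.2 hp.1)
    (sub_eq_zero.1 h)
  exact hp2 (by linarith)

theorem one_le_hyperconst {p : ℝ} (hp : p ∈ Set.Ioo (0 : ℝ) 1) (hp2 : p ≠ 1 / 2) :
    1 ≤ hyperconst p := by
  obtain ⟨v, hv⟩ : ∃ v, v = log (1 - p) - log p := ⟨_, rfl⟩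
  have hv0 : v ≠ 0 := hv ▸ log_one_sub_sub_log_ne_zero hp hp2
  have e1 : (1 - p) / p = exp v := by
    rw [hv, exp_sub, exp_log (by linarith [hp.2]), exp_log hp.1]
  have e2 : p / (1 - p) = exp (-v) := by rw [exp_neg, ← e1, inv_div]
  have h : hyperconst p = sinh v / v := by
    rw [hyperconst, e1, e2, ← hv, sinh_eq, div_div]
  rw [h]
  rcases lt_or_gt_of_ne hv0 with h0 | h0
  · rw [le_div_iff_of_neg h0, one_mul]
    exact sinh_le_self_iff.2 h0.le
  · rw [le_div_iff₀ h0, one_mul]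
    exact self_le_sinh_iff.2 h0.le

/-- The Kearns-Saul inequality. -/
theorem kearns_saul {p : ℝ} (hp : p ∈ Set.Ioo (0 : ℝ) 1) (hp2 : p ≠ 1 / 2) (t : ℝ) :
    p * exp (t * ((1 - p) / √(p * (1 - p)))) + (1 - p) * exp (t * ((0 - p) / √(p * (1 - p)))) ≤
      exp (hyperconst p * t ^ 2 / 2) := by
  have h1p : 0 < 1 - p := by linarith [hp.2]
  have hs2 : √(p * (1 - p)) ^ 2 = p * (1 - p) := sq_sqrt (mul_pos hp.1 h1p).le
  have hs : 0 < √(p * (1 - p)) := sqrt_pos.2 (mul_pos hp.1 h1p)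
  set σ := √(p * (1 - p)) with hσ
  obtain ⟨v, hv⟩ : ∃ v, v = (log (1 - p) - log p) / 2 := ⟨_, rfl⟩
  have hv0 : v ≠ 0 := by
    rw [hv]; exact div_ne_zero (log_one_sub_sub_log_ne_zero hp hp2) two_ne_zero
  obtain ⟨e1, e2⟩ := bias_eq_exp hp hv
  have hc := cosh_pos v
  -- In this variable the moment generating function is `exp ((m+v) tanh v) * cosh m / cosh v`. The
  -- tangent bound at `m^2 = v^2` then finishes, because `(m+v) + (m^2-v^2)/(2v) = (m+v)^2/(2v)`.
  obtain ⟨m, hm⟩ : ∃ m, m = t / σ / 2 - v := ⟨_, rfl⟩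
  have ht : t = 2 * (m + v) * σ := by rw [hm]; field_simp; ring
  have hth : 1 - 2 * p = sinh v / cosh v := by
    have : 1 - 2 * p = (1 - p) - p := by ring
    rw [this]
    calc (1 - p) - p = exp v / (2 * cosh v) - exp (-v) / (2 * cosh v) := by rw [← e1, ← e2]
      _ = sinh v / cosh v := by rw [sinh_eq]; field_simp
  have hB : hyperconst p * t ^ 2 / 2 = sinh v / cosh v / v / 2 * (m + v) ^ 2 := by
    rw [hyperconst_eq hp, ← hth, show log (1 - p) - log p = 2 * v by rw [hv]; ring, ht, mul_pow,
      hs2]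
    have := hp.1.ne'
    have := h1p.ne'
    field_simp
  have hlog := log_cosh_le m hv0
  have hcosh : cosh m ≤ cosh v * exp (sinh v / cosh v / v / 2 * (m ^ 2 - v ^ 2)) := by
    rw [← log_le_log_iff (cosh_pos m) (by positivity), log_mul hc.ne' (exp_pos _).ne', log_exp]
    exact hlog
  have hL : p * exp (t * ((1 - p) / σ)) + (1 - p) * exp (t * ((0 - p) / σ)) =
      exp ((m + v) * (1 - 2 * p)) * (cosh m / cosh v) := by
    have a1 : t * ((1 - p) / σ) = (m + v) * (1 - 2 * p) + m + v := by
      rw [ht]; field_simp; ring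
    have a2 : t * ((0 - p) / σ) = (m + v) * (1 - 2 * p) + -m + -v := by
      rw [ht]; field_simp; ring
    rw [a1, a2, exp_add, exp_add, exp_add, exp_add]
    have b1 : p * exp v = 1 / (2 * cosh v) := by
      nth_rw 1 [e1]
      rw [div_mul_eq_mul_div, ← exp_add]; simp
    have b2 : (1 - p) * exp (-v) = 1 / (2 * cosh v) := by
      nth_rw 1 [e2]
      rw [div_mul_eq_mul_div, ← exp_add]; simp
    calc _ = exp ((m + v) * (1 - 2 * p)) * (exp m * (p * exp v) + exp (-m) *
          ((1 - p) * exp (-v))) := by ring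
      _ = _ := by rw [b1, b2, cosh_eq m]; field_simp
  rw [hL, hB, hth]
  calc _ ≤ exp ((m + v) * (sinh v / cosh v)) *
        exp (sinh v / cosh v / v / 2 * (m ^ 2 - v ^ 2)) := by
        gcongr
        rwa [div_le_iff₀' hc]
    _ = _ := by
        rw [← exp_add]; congr 1; field_simp; ring

/-- Two-point moment bound for nonnegative functions. -/
theorem two_point_moment {p : ℝ} (hp : p ∈ Set.Ioo (0 : ℝ) 1) (hp2 : p ≠ 1 / 2) {b q : ℝ}
    (hq : 0 < q) (h1 : 0 ≤ 1 + b * ((1 - p) / √(p * (1 - p))))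
    (h0 : 0 ≤ 1 + b * ((0 - p) / √(p * (1 - p)))) :
    p * (1 + b * ((1 - p) / √(p * (1 - p)))) ^ q + (1 - p) * (1 + b * ((0 - p) / √(p * (1 - p)))) ^ q
      ≤ (1 + hyperconst p * q * b ^ 2) ^ (q / 2) := by
  have h1p : 0 < 1 - p := by linarith [hp.2]
  have hB : 0 < hyperconst p := by linarith [one_le_hyperconst hp hp2]
  obtain ⟨K, hK⟩ : ∃ K, K = hyperconst p * q * b ^ 2 := ⟨_, rfl⟩
  have hK0 : 0 ≤ K := by rw [hK]; positivity
  -- The bound `u ≤ exp (u-1)` at `u = (1+by)/s` replaces the power by an exponential, to which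
  -- Kearns–Saul applies. With `s^2 = 1+K` the exponent left over is `-(q/2)(1-1/s)^2 ≤ 0`.
  obtain ⟨s, hs⟩ : ∃ s, s = √(1 + K) := ⟨_, rfl⟩
  have hs2 : s ^ 2 = 1 + K := by rw [hs, sq_sqrt (by linarith)]
  have hs0 : 0 < s := by rw [hs]; positivity
  have key : ∀ y : ℝ, 0 ≤ 1 + b * y →
      (1 + b * y) ^ q ≤ s ^ q * exp (q * (1 / s - 1)) * exp (q * b / s * y) := by
    intro y hy
    have : 1 + b * y ≤ s * exp ((1 + b * y) / s - 1) := by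
      have := add_one_le_exp ((1 + b * y) / s - 1)
      rw [sub_add_cancel, div_le_iff₀' hs0] at this
      exact this
    calc (1 + b * y) ^ q ≤ (s * exp ((1 + b * y) / s - 1)) ^ q := rpow_le_rpow hy this hq.le
      _ = _ := by
        rw [mul_rpow hs0.le (exp_pos _).le, ← exp_mul, mul_assoc, ← exp_add]
        congr 2; field_simp; ring
  have ks := kearns_saul hp hp2 (q * b / s)
  have hexp : exp (q * (1 / s - 1)) * exp (hyperconst p * (q * b / s) ^ 2 / 2) ≤ 1 := by
    rw [← exp_add, exp_le_one_iff]
    have e : hyperconst p * (q * b / s) ^ 2 / 2 = q * (s ^ 2 - 1) / s ^ 2 / 2 := by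
      rw [show s ^ 2 - 1 = K by linarith, hK]; field_simp
    have : q * (1 / s - 1) + q * (s ^ 2 - 1) / s ^ 2 / 2 = -(q / 2 * (1 - 1 / s) ^ 2) := by
      field_simp; ring
    rw [e, this]
    have : 0 ≤ q / 2 * (1 - 1 / s) ^ 2 := by positivity
    linarith
  have hpow : (1 + K) ^ (q / 2) = s ^ q := by
    rw [← hs2, ← rpow_natCast, ← rpow_mul hs0.le]; congr 1; push_cast; ring
  rw [← hK, hpow]
  calc _ ≤ p * (s ^ q * exp (q * (1 / s - 1)) * exp (q * b / s * ((1 - p) / √(p * (1 - p))))) +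
        (1 - p) * (s ^ q * exp (q * (1 / s - 1)) * exp (q * b / s * ((0 - p) / √(p * (1 - p))))) :=
        add_le_add (mul_le_mul_of_nonneg_left (key _ h1) hp.1.le)
          (mul_le_mul_of_nonneg_left (key _ h0) h1p.le)
    _ = s ^ q * exp (q * (1 / s - 1)) * (p * exp (q * b / s * ((1 - p) / √(p * (1 - p)))) +
        (1 - p) * exp (q * b / s * ((0 - p) / √(p * (1 - p))))) := by ring
    _ ≤ s ^ q * exp (q * (1 / s - 1)) * exp (hyperconst p * (q * b / s) ^ 2 / 2) := by gcongr
    _ = s ^ q * (exp (q * (1 / s - 1)) * exp (hyperconst p * (q * b / s) ^ 2 / 2)) := by ring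
    _ ≤ s ^ q * 1 := by gcongr
    _ = s ^ q := mul_one _

/-! ### Biased Fourier analysis: noise, derivatives, averages. -/

/-- The one-bit `p`-biased measure. -/
noncomputable def bitMass (p : ℝ) (b : Bool) : ℝ := if b then p else 1 - p

/-- The normalized `p`-biased bit. -/
noncomputable def bitChar (p : ℝ) (b : Bool) : ℝ :=
  ((if b then 1 else 0) - p) / √(p * (1 - p))

/-- The transition kernel that keeps a bit with probability `ρ` and resamples it otherwise. -/
noncomputable def bitNoise (p ρ : ℝ) (a b : Bool) : ℝ :=
  (if a = b then ρ else 0) + (1 - ρ) * bitMass p b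

/-- The noise operator with correlation `ρ`. -/
noncomputable def noiseOp {n : ℕ} (p ρ : ℝ) (f : (Fin n → Bool) → ℝ) (x : Fin n → Bool) : ℝ :=
  ∑ y, (∏ i, bitNoise p ρ (x i) (y i)) * f y

/-- The normalized discrete derivative in direction `i`. -/
noncomputable def biasedDeriv {n : ℕ} (p : ℝ) (i : Fin n) (f : (Fin n → Bool) → ℝ)
    (x : Fin n → Bool) : ℝ :=
  √(p * (1 - p)) * (f (Function.update x i true) - f (Function.update x i false))

/-- The average over coordinate `i`. -/
noncomputable def biasedAvg {n : ℕ} (p : ℝ) (i : Fin n) (f : (Fin n → Bool) → ℝ)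
    (x : Fin n → Bool) : ℝ :=
  p * f (Function.update x i true) + (1 - p) * f (Function.update x i false)

section

variable {n : ℕ} {p ρ : ℝ}

theorem bitMass_nonneg (hp : p ∈ Set.Ioo (0 : ℝ) 1) (b : Bool) : 0 ≤ bitMass p b := by
  have := hp.1; have := hp.2
  cases b <;> simp [bitMass] <;> linarith

theorem bitNoise_nonneg (hp : p ∈ Set.Ioo (0 : ℝ) 1) (hρ : ρ ∈ Set.Icc (0 : ℝ) 1) (a b : Bool) :
    0 ≤ bitNoise p ρ a b := by
  have h1 := hρ.1
  have h2 : 0 ≤ 1 - ρ := by linarith [hρ.2]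
  have h3 := mul_nonneg h2 (bitMass_nonneg hp b)
  unfold bitNoise
  split_ifs <;> linarith

theorem sqrt_bias_pos (hp : p ∈ Set.Ioo (0 : ℝ) 1) : 0 < √(p * (1 - p)) :=
  sqrt_pos.2 (mul_pos hp.1 (by linarith [hp.2]))

theorem sq_sqrt_bias (hp : p ∈ Set.Ioo (0 : ℝ) 1) : √(p * (1 - p)) ^ 2 = p * (1 - p) :=
  sq_sqrt (mul_pos hp.1 (by linarith [hp.2])).le

theorem bitChar_mul_bitChar (hp : p ∈ Set.Ioo (0 : ℝ) 1) (a b : Bool) :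
    bitMass p a * (1 + bitChar p a * bitChar p b) = if a = b then 1 else 0 := by
  have h := sq_sqrt_bias hp
  have h0 := (sqrt_bias_pos hp).ne'
  have hp0 := hp.1.ne'
  have hp1 : 1 - p ≠ 0 := by linarith [hp.2]
  have e : bitChar p a * bitChar p b =
      (((if a then 1 else 0) - p) * ((if b then 1 else 0) - p)) / (p * (1 - p)) := by
    rw [bitChar, bitChar, div_mul_div_comm, ← sq, h]
  rw [e]
  cases a <;> cases b <;> simp only [bitMass, reduceIte, Bool.false_eq_true, reduceCtorEq] <;>
    field_simp <;> ring

theorem mass_true_mul_bitChar (hp : p ∈ Set.Ioo (0 : ℝ) 1) :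
    p * bitChar p true = √(p * (1 - p)) := by
  have h := sq_sqrt_bias hp
  have h0 := (sqrt_bias_pos hp).ne'
  rw [bitChar, ← mul_div_assoc, div_eq_iff h0, ← sq, h]; simp

theorem mass_false_mul_bitChar (hp : p ∈ Set.Ioo (0 : ℝ) 1) :
    (1 - p) * bitChar p false = -√(p * (1 - p)) := by
  have h := sq_sqrt_bias hp
  have h0 := (sqrt_bias_pos hp).ne'
  rw [bitChar, ← mul_div_assoc, div_eq_iff h0, neg_mul, ← sq, h]; simp; ring

theorem sum_bitMass_mul_bitNoise (a : Bool) :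
    ∑ b, bitMass p b * bitNoise p ρ b a = bitMass p a := by
  cases a <;> simp [bitMass, bitNoise] <;> ring

theorem sum_bitMass_mul_bitChar_mul_bitNoise (hp : p ∈ Set.Ioo (0 : ℝ) 1) (a : Bool) :
    ∑ b, bitMass p b * bitChar p b * bitNoise p ρ b a = ρ * (bitMass p a * bitChar p a) := by
  have h1 := mass_true_mul_bitChar hp
  have h2 := mass_false_mul_bitChar hp
  cases a <;> simp [bitMass, bitNoise]
  · linear_combination (1 - ρ) * (1 - p) * (h1 + h2)
  · linear_combination (1 - ρ) * p * (h1 + h2)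

theorem sum_pi_bool_prod (g : Fin n → Bool → ℝ) :
    ∑ x : Fin n → Bool, ∏ i, g i (x i) = ∏ i, ∑ b, g i b :=
  (Fintype.prod_sum g).symm

theorem biasedMass_nonneg (hp : p ∈ Set.Ioo (0 : ℝ) 1) (x : Fin n → Bool) :
    0 ≤ biasedMass p x :=
  Finset.prod_nonneg fun i _ => bitMass_nonneg hp (x i)

theorem biasedMass_eq (x : Fin n → Bool) : biasedMass p x = ∏ i, bitMass p (x i) := rfl

theorem biasedChar_eq (S : Finset (Fin n)) (x : Fin n → Bool) :
    biasedChar p S x = ∏ i, if i ∈ S then bitChar p (x i) else 1 := by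
  rw [Finset.prod_ite_mem, Finset.univ_inter]; rfl

theorem sum_biasedMass : ∑ x : Fin n → Bool, biasedMass p x = 1 := by
  simp only [biasedMass_eq, sum_pi_bool_prod]
  simp [bitMass]

theorem biasedFourier_noiseOp (hp : p ∈ Set.Ioo (0 : ℝ) 1) (f : (Fin n → Bool) → ℝ)
    (S : Finset (Fin n)) :
    biasedFourier p (noiseOp p ρ f) S = ρ ^ S.card * biasedFourier p f S := by
  simp only [biasedFourier, biasedExp, noiseOp, Finset.sum_mul, Finset.mul_sum]
  rw [Finset.sum_comm]
  refine Finset.sum_congr rfl fun y _ => ?_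
  have h : ∑ x : Fin n → Bool, ∏ i, (bitMass p (x i) * (if i ∈ S then bitChar p (x i) else 1) *
      bitNoise p ρ (x i) (y i)) =
      ∏ i, ((if i ∈ S then ρ else 1) * (bitMass p (y i) * if i ∈ S then bitChar p (y i) else 1)) := by
    rw [sum_pi_bool_prod fun i b => bitMass p b * (if i ∈ S then bitChar p b else 1) *
      bitNoise p ρ b (y i)]
    refine Finset.prod_congr rfl fun i _ => ?_
    by_cases hi : i ∈ S
    · simpa [hi] using sum_bitMass_mul_bitChar_mul_bitNoise (ρ := ρ) hp (y i)
    · simpa [hi] using sum_bitMass_mul_bitNoise (p := p) (ρ := ρ) (y i)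
  have h2 : ∏ i, (if i ∈ S then ρ else 1) = ρ ^ S.card := by
    rw [Finset.prod_ite_mem, Finset.univ_inter, Finset.prod_const]
  simp only [Finset.prod_mul_distrib, ← biasedMass_eq, ← biasedChar_eq, h2] at h
  calc _ = (∑ x, biasedMass p x * biasedChar p S x * ∏ i, bitNoise p ρ (x i) (y i)) * f y := by
        rw [Finset.sum_mul]; exact Finset.sum_congr rfl fun x _ => by ring
    _ = _ := by rw [h]; ring

/-- Plancherel, from completeness: `∑_S χ_S(x) χ_S(y)` factors as `∏ (1 + χ(x_i) χ(y_i))`, which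
vanishes off the diagonal and is the inverse mass on it. -/
theorem sum_biasedFourier_mul (hp : p ∈ Set.Ioo (0 : ℝ) 1) (f g : (Fin n → Bool) → ℝ) :
    ∑ S, biasedFourier p f S * biasedFourier p g S = biasedExp p fun x => f x * g x := by
  have key : ∀ x y : Fin n → Bool, biasedMass p x * ∑ S, biasedChar p S x * biasedChar p S y =
      if x = y then 1 else 0 := by
    intro x y
    have h : ∑ S, biasedChar p S x * biasedChar p S y =
        ∏ i, (1 + bitChar p (x i) * bitChar p (y i)) := by
      rw [Finset.prod_one_add, Finset.powerset_univ]
      refine Finset.sum_congr rfl fun S _ => ?_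
      rw [Finset.prod_mul_distrib]; rfl
    rw [h, biasedMass_eq, ← Finset.prod_mul_distrib]
    simp only [bitChar_mul_bitChar hp]
    rw [Finset.prod_ite_zero]
    simp [funext_iff]
  simp only [biasedFourier, biasedExp, Finset.sum_mul_sum]
  rw [Finset.sum_comm]
  refine Finset.sum_congr rfl fun x _ => ?_
  rw [Finset.sum_comm]
  calc _ = ∑ y, f x * (biasedMass p y * g y) *
        (biasedMass p x * ∑ S, biasedChar p S x * biasedChar p S y) := by
        refine Finset.sum_congr rfl fun y _ => ?_
        rw [Finset.mul_sum, Finset.mul_sum]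
        exact Finset.sum_congr rfl fun S _ => by ring
    _ = _ := by
        simp only [key]
        simp
        ring

/-- Swapping `x i` with an independent fresh bit is an involution preserving the product measure. -/
theorem biasedExp_avg (i : Fin n) (g : (Fin n → Bool) → ℝ) :
    biasedExp p (biasedAvg p i g) = biasedExp p g := by
  have h1 : biasedExp p (biasedAvg p i g) = ∑ z : (Fin n → Bool) × Bool,
      biasedMass p z.1 * bitMass p z.2 * g (Function.update z.1 i z.2) := by
    rw [Fintype.sum_prod_type]
    simp only [biasedExp, biasedAvg]
    refine Finset.sum_congr rfl fun x _ => ?_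
    simp [bitMass]; ring
  have h2 : biasedExp p g = ∑ z : (Fin n → Bool) × Bool,
      biasedMass p z.1 * bitMass p z.2 * g z.1 := by
    rw [Fintype.sum_prod_type]
    refine Finset.sum_congr rfl fun x _ => ?_
    simp [bitMass]; ring
  rw [h1, h2]
  let e : (Fin n → Bool) × Bool → (Fin n → Bool) × Bool :=
    fun z => (Function.update z.1 i z.2, z.1 i)
  have he : Function.Involutive e := fun z => by simp [e]
  refine Fintype.sum_equiv he.toPerm _ _ fun z => ?_
  have hm : ∀ x : Fin n → Bool, biasedMass p x =
      bitMass p (x i) * ∏ j ∈ Finset.univ.erase i, bitMass p (x j) := fun x => by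
    rw [biasedMass_eq, Finset.mul_prod_erase _ (fun j => bitMass p (x j)) (Finset.mem_univ i)]
  have hu : ∏ j ∈ Finset.univ.erase i, bitMass p (Function.update z.1 i z.2 j) =
      ∏ j ∈ Finset.univ.erase i, bitMass p (z.1 j) :=
    Finset.prod_congr rfl fun j hj => by rw [Function.update_of_ne (Finset.ne_of_mem_erase hj)]
  simp only [Function.Involutive.coe_toPerm, e]
  rw [hm z.1, hm (Function.update z.1 i z.2), hu, Function.update_self]
  ring

theorem biasedChar_update_of_notMem {S : Finset (Fin n)} {i : Fin n} (hi : i ∉ S)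
    (x : Fin n → Bool) (b : Bool) : biasedChar p S (Function.update x i b) = biasedChar p S x :=
  Finset.prod_congr rfl fun j hj => by
    rw [Function.update_of_ne (fun h : j = i => hi (h ▸ hj))]

theorem biasedChar_insert {S : Finset (Fin n)} {i : Fin n} (hi : i ∉ S) (x : Fin n → Bool) :
    biasedChar p (insert i S) x = bitChar p (x i) * biasedChar p S x :=
  Finset.prod_insert hi

theorem biasedFourier_insert (hp : p ∈ Set.Ioo (0 : ℝ) 1) {S : Finset (Fin n)} {i : Fin n}
    (hi : i ∉ S) (f : (Fin n → Bool) → ℝ) :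
    biasedFourier p f (insert i S) = biasedFourier p (biasedDeriv p i f) S := by
  have h1 := mass_true_mul_bitChar hp
  have h2 := mass_false_mul_bitChar hp
  rw [biasedFourier, ← biasedExp_avg i, biasedFourier]
  congr 1
  funext x
  simp only [biasedAvg, biasedDeriv, biasedChar_insert hi, biasedChar_update_of_notMem hi,
    Function.update_self]
  linear_combination f (Function.update x i true) * biasedChar p S x * h1 +
    f (Function.update x i false) * biasedChar p S x * h2

theorem biasedFourier_avg_of_notMem {S : Finset (Fin n)} {i : Fin n}
    (hi : i ∉ S) (f : (Fin n → Bool) → ℝ) :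
    biasedFourier p (biasedAvg p i f) S = biasedFourier p f S := by
  conv_rhs => rw [biasedFourier, ← biasedExp_avg i]
  rw [biasedFourier]
  congr 1
  funext x
  simp only [biasedAvg, biasedChar_update_of_notMem hi]
  ring

theorem biasedFourier_eq_zero_of_mem (hp : p ∈ Set.Ioo (0 : ℝ) 1) {S : Finset (Fin n)} {i : Fin n}
    (hi : i ∈ S) {g : (Fin n → Bool) → ℝ} (hg : ∀ x b, g (Function.update x i b) = g x) :
    biasedFourier p g S = 0 := by
  have h1 := mass_true_mul_bitChar hp
  have h2 := mass_false_mul_bitChar hp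
  have hS : i ∉ S.erase i := Finset.notMem_erase i S
  rw [← Finset.insert_erase hi, biasedFourier_insert hp hS, biasedFourier]
  simp [biasedDeriv, hg, biasedExp]

theorem biasedFourier_deriv_of_mem (hp : p ∈ Set.Ioo (0 : ℝ) 1) {S : Finset (Fin n)} {i : Fin n}
    (hi : i ∈ S) (f : (Fin n → Bool) → ℝ) : biasedFourier p (biasedDeriv p i f) S = 0 :=
  biasedFourier_eq_zero_of_mem hp hi fun x b => by simp [biasedDeriv]

/-- The noise kernel is nonnegative and has `μ_p` as stationary measure. -/
theorem biasedExp_abs_noiseOp_le (hp : p ∈ Set.Ioo (0 : ℝ) 1) (hρ : ρ ∈ Set.Icc (0 : ℝ) 1)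
    (f : (Fin n → Bool) → ℝ) :
    biasedExp p (fun x => |noiseOp p ρ f x|) ≤ biasedExp p fun x => |f x| := by
  have h : ∀ y : Fin n → Bool,
      ∑ x : Fin n → Bool, biasedMass p x * ∏ i, bitNoise p ρ (x i) (y i) = biasedMass p y := by
    intro y
    simp only [biasedMass_eq, ← Finset.prod_mul_distrib]
    rw [sum_pi_bool_prod fun i b => bitMass p b * bitNoise p ρ b (y i)]
    simp only [sum_bitMass_mul_bitNoise]
  calc _ ≤ ∑ x, biasedMass p x * ∑ y, (∏ i, bitNoise p ρ (x i) (y i)) * |f y| := by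
        refine Finset.sum_le_sum fun x _ => mul_le_mul_of_nonneg_left ?_ (biasedMass_nonneg hp x)
        refine (Finset.abs_sum_le_sum_abs _ _).trans (Finset.sum_le_sum fun y _ => ?_)
        rw [abs_mul, abs_of_nonneg (Finset.prod_nonneg fun i _ => bitNoise_nonneg hp hρ _ _)]
    _ = ∑ y, (∑ x : Fin n → Bool, biasedMass p x * ∏ i, bitNoise p ρ (x i) (y i)) * |f y| := by
        simp only [Finset.mul_sum, Finset.sum_mul]
        rw [Finset.sum_comm]
        exact Finset.sum_congr rfl fun y _ => Finset.sum_congr rfl fun x _ => by ring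
    _ = _ := by simp only [h]; rfl

theorem noiseCorrelation_eq (ε : ℝ) (f : (Fin n → Bool) → ℝ) :
    noiseCorrelation p ε f = biasedExp p fun x => f x * noiseOp p (1 - ε) f x := by
  have key : ∀ x y : Fin n → Bool, ∑ r : Fin n → Bool, ∑ z : Fin n → Bool,
      biasedMass ε r * biasedMass p z * (if (fun i => if r i then z i else x i) = y then 1 else 0)
      = ∏ i, bitNoise p (1 - ε) (x i) (y i) := by
    intro x y
    have h1 : ∀ r z : Fin n → Bool, biasedMass ε r * biasedMass p z *
        (if (fun i => if r i then z i else x i) = y then 1 else 0) =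
        ∏ i, (bitMass ε (r i) * bitMass p (z i) *
          if (if r i then z i else x i) = y i then 1 else 0) := by
      intro r z
      rw [Finset.prod_mul_distrib, Finset.prod_mul_distrib, Finset.prod_ite_zero]
      simp [funext_iff, biasedMass_eq]
    simp only [h1]
    have h2 : ∀ r : Fin n → Bool, ∑ z : Fin n → Bool, ∏ i, (bitMass ε (r i) * bitMass p (z i) *
          if (if r i then z i else x i) = y i then 1 else 0) = ∏ i, ∑ b, (bitMass ε (r i) *
          bitMass p b * if (if r i then b else x i) = y i then 1 else 0) := fun r =>
      sum_pi_bool_prod fun i b => bitMass ε (r i) * bitMass p b *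
        if (if r i then b else x i) = y i then 1 else 0
    simp only [h2]
    rw [sum_pi_bool_prod fun i a => ∑ b, (bitMass ε a * bitMass p b *
      if (if a then b else x i) = y i then 1 else 0)]
    refine Finset.prod_congr rfl fun i _ => ?_
    cases x i <;> cases y i <;> simp [bitMass, bitNoise] <;> ring
  simp only [noiseCorrelation, biasedExp, noiseOp, ← key]
  refine Finset.sum_congr rfl fun x _ => ?_
  congr 1
  simp only [Finset.mul_sum, Finset.sum_mul]
  conv_rhs => rw [Finset.sum_comm]
  refine Finset.sum_congr rfl fun r _ => ?_
  conv_rhs => rw [Finset.sum_comm]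
  refine Finset.sum_congr rfl fun z _ => ?_
  simp
  ring

end

/-! ### Hypercontractivity. -/

section

variable {n : ℕ} {p c κ : ℝ}

/-- Smoothing turns mean `A` and Fourier coefficient `d` into `A + c d χ`. After division by `A`,
the moment bound with `q = κ⁻¹` applies, and the choice of `c` cancels `B q`, leaving `1 + d^2/A^2`.
-/
theorem bit_hypercontractive (hp : p ∈ Set.Ioo (0 : ℝ) 1) (hp2 : p ≠ 1 / 2) (hκ : 0 < κ)
    (hc : c ∈ Set.Icc (0 : ℝ) 1) (hcκ : c ^ 2 = κ / hyperconst p) (V : Bool → ℝ)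
    (hV : ∀ b, 0 ≤ V b) :
    (∑ a, bitMass p a * (∑ b, bitNoise p c a b * V b) ^ κ⁻¹) ^ κ ≤
      √(∑ b, bitMass p b * V b ^ 2) := by
  have h1p : 0 < 1 - p := by linarith [hp.2]
  have hB : 0 < hyperconst p := by linarith [one_le_hyperconst hp hp2]
  have hs := sqrt_bias_pos hp
  have hs2 := sq_sqrt_bias hp
  obtain ⟨A, hA⟩ : ∃ A, A = p * V true + (1 - p) * V false := ⟨_, rfl⟩
  obtain ⟨d, hd⟩ : ∃ d, d = √(p * (1 - p)) * (V true - V false) := ⟨_, rfl⟩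
  have hN : ∀ a, ∑ b, bitNoise p c a b * V b = A + c * d * bitChar p a := by
    intro a
    have : d * bitChar p a = (V true - V false) * ((if a then 1 else 0) - p) := by
      rw [hd, bitChar]; field_simp
    rw [mul_assoc, this, hA]
    cases a <;> simp [bitNoise, bitMass] <;> ring
  have hV2 : ∑ b, bitMass p b * V b ^ 2 = A ^ 2 + d ^ 2 := by
    rw [hd, mul_pow, hs2, hA]
    simp [bitMass]; ring
  have hNn : ∀ a, 0 ≤ A + c * d * bitChar p a := fun a => by
    rw [← hN]
    exact Finset.sum_nonneg fun b _ => mul_nonneg (bitNoise_nonneg hp hc a b) (hV b)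
  have hA0 : 0 ≤ A := by
    rw [hA]; exact add_nonneg (mul_nonneg hp.1.le (hV _)) (mul_nonneg h1p.le (hV _))
  simp only [hN, hV2]
  rcases hA0.eq_or_lt with hA0 | hA0
  · have h1 : V true = 0 := by
      have := mul_nonneg h1p.le (hV false)
      have h : p * V true ≤ 0 := by linarith
      exact le_antisymm (nonpos_of_mul_nonpos_right h hp.1) (hV _)
    have h0 : V false = 0 := by
      have := mul_nonneg hp.1.le (hV true)
      have h : (1 - p) * V false ≤ 0 := by linarith
      exact le_antisymm (nonpos_of_mul_nonpos_right h h1p) (hV _)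
    have hd0 : d = 0 := by rw [hd, h1, h0]; simp
    simp [← hA0, hd0, hκ.ne', zero_rpow]
  · have hdiv : ∀ a, A + c * d * bitChar p a = A * (1 + c * d / A * bitChar p a) := fun a => by
      field_simp
    have hn : ∀ a, 0 ≤ 1 + c * d / A * bitChar p a := fun a => by
      have := hNn a
      rw [hdiv] at this
      exact nonneg_of_mul_nonneg_right this hA0
    have h := two_point_moment hp hp2 (b := c * d / A) (inv_pos.2 hκ)
      (by simpa [bitChar] using hn true) (by simpa [bitChar] using hn false)
    have e1 : ∑ a, bitMass p a * (A + c * d * bitChar p a) ^ κ⁻¹ =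
        A ^ κ⁻¹ * (p * (1 + c * d / A * ((1 - p) / √(p * (1 - p)))) ^ κ⁻¹ +
          (1 - p) * (1 + c * d / A * ((0 - p) / √(p * (1 - p)))) ^ κ⁻¹) := by
      simp only [hdiv, mul_rpow hA0.le (hn _)]
      simp [bitMass, bitChar]; ring
    have e2 : 1 + hyperconst p * κ⁻¹ * (c * d / A) ^ 2 = (A ^ 2 + d ^ 2) / A ^ 2 := by
      rw [div_pow, mul_pow, hcκ]; field_simp
    have hpos : 0 ≤ A ^ 2 + d ^ 2 := by positivity
    have e3 : A ^ κ⁻¹ * ((A ^ 2 + d ^ 2) / A ^ 2) ^ (κ⁻¹ / 2) = (A ^ 2 + d ^ 2) ^ (κ⁻¹ / 2) := by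
      have : (A ^ 2) ^ (κ⁻¹ / 2) = A ^ κ⁻¹ := by
        rw [← rpow_natCast, ← rpow_mul hA0.le]; congr 1; push_cast; ring
      rw [div_rpow hpos (by positivity), this, mul_div_cancel₀ _ (rpow_pos_of_pos hA0 _).ne']
    have h2 : ∑ a, bitMass p a * (A + c * d * bitChar p a) ^ κ⁻¹ ≤
        (A ^ 2 + d ^ 2) ^ (κ⁻¹ / 2) := by
      rw [e1, ← e3, ← e2]
      exact mul_le_mul_of_nonneg_left h (rpow_nonneg hA0.le _)
    calc _ ≤ ((A ^ 2 + d ^ 2) ^ (κ⁻¹ / 2)) ^ κ := by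
          refine rpow_le_rpow (Finset.sum_nonneg fun a _ => ?_) h2 hκ.le
          exact mul_nonneg (bitMass_nonneg hp a) (rpow_nonneg (hNn a) _)
      _ = √(A ^ 2 + d ^ 2) := by
          rw [← rpow_mul hpos, sqrt_eq_rpow]; congr 1; field_simp

theorem bit_noise_bilinear_le (hp : p ∈ Set.Ioo (0 : ℝ) 1) (hp2 : p ≠ 1 / 2)
    (hκ : κ ∈ Set.Ioo (0 : ℝ) 1) (hc : c ∈ Set.Icc (0 : ℝ) 1) (hcκ : c ^ 2 = κ / hyperconst p)
    (U V : Bool → ℝ) (hU : ∀ b, 0 ≤ U b) (hV : ∀ b, 0 ≤ V b) :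
    ∑ a, ∑ b, bitMass p a * bitNoise p c a b * (U a * V b) ≤
      (∑ a, bitMass p a * U a ^ (1 - κ)⁻¹) ^ (1 - κ) * √(∑ b, bitMass p b * V b ^ 2) := by
  have h1κ : 0 < 1 - κ := by linarith [hκ.2]
  have hW : ∀ a, 0 ≤ ∑ b, bitNoise p c a b * V b := fun a =>
    Finset.sum_nonneg fun b _ => mul_nonneg (bitNoise_nonneg hp hc a b) (hV b)
  calc _ = ∑ a, bitMass p a * ((U a ^ (1 - κ)⁻¹) ^ (1 - κ) *
        ((∑ b, bitNoise p c a b * V b) ^ κ⁻¹) ^ κ) := by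
        refine Finset.sum_congr rfl fun a _ => ?_
        rw [rpow_inv_rpow (hU a) h1κ.ne', rpow_inv_rpow (hW a) hκ.1.ne', Finset.mul_sum,
          Finset.mul_sum]
        exact Finset.sum_congr rfl fun b _ => by ring
    _ ≤ _ := sum_mul_rpow_mul_rpow_le _ _ _ _ (fun a _ => bitMass_nonneg hp a)
        (fun a _ => rpow_nonneg (hU a) _) (fun a _ => rpow_nonneg (hW a) _) hκ.1 hκ.2
    _ ≤ _ := by
        refine mul_le_mul_of_nonneg_left (bit_hypercontractive hp hp2 hκ.1 hc hcκ V hV) ?_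
        exact rpow_nonneg (Finset.sum_nonneg fun a _ =>
          mul_nonneg (bitMass_nonneg hp a) (rpow_nonneg (hU a) _)) _

theorem sum_bool_cons (F : (Fin (n + 1) → Bool) → ℝ) :
    ∑ x, F x = ∑ a, ∑ x : Fin n → Bool, F (Fin.cons a x) := by
  rw [← Fintype.sum_prod_type']
  exact (Fintype.sum_equiv (Fin.consEquiv fun _ => Bool) _ _ fun _ => rfl).symm

theorem biasedExp_cons (F : (Fin (n + 1) → Bool) → ℝ) :
    biasedExp p F = ∑ a, bitMass p a * biasedExp p fun x : Fin n → Bool => F (Fin.cons a x) := by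
  simp only [biasedExp]
  rw [sum_bool_cons]
  refine Finset.sum_congr rfl fun a _ => ?_
  rw [Finset.mul_sum]
  refine Finset.sum_congr rfl fun x _ => ?_
  rw [biasedMass_eq, Fin.prod_univ_succ]
  simp [biasedMass_eq, mul_assoc]

theorem biasedExp_nonneg (hp : p ∈ Set.Ioo (0 : ℝ) 1) {g : (Fin n → Bool) → ℝ}
    (hg : ∀ x, 0 ≤ g x) : 0 ≤ biasedExp p g :=
  Finset.sum_nonneg fun x _ => mul_nonneg (biasedMass_nonneg hp x) (hg x)

/-- The bilinear form tensorizes without Minkowski: the induction hypothesis bounds each pair of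
slices by a product of their norms, and the one-bit inequality is applied to those norms. -/
theorem noise_bilinear_le (hp : p ∈ Set.Ioo (0 : ℝ) 1) (hp2 : p ≠ 1 / 2)
    (hκ : κ ∈ Set.Ioo (0 : ℝ) 1) (hc : c ∈ Set.Icc (0 : ℝ) 1) (hcκ : c ^ 2 = κ / hyperconst p)
    (u v : (Fin n → Bool) → ℝ) (hu : ∀ x, 0 ≤ u x) (hv : ∀ x, 0 ≤ v x) :
    biasedExp p (fun x => u x * noiseOp p c v x) ≤
      biasedExp p (fun x => u x ^ (1 - κ)⁻¹) ^ (1 - κ) * √(biasedExp p fun x => v x ^ 2) := by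
  have h1κ : 0 < 1 - κ := by linarith [hκ.2]
  induction n with
  | zero =>
    simp only [biasedExp, noiseOp, Fintype.sum_unique, biasedMass, Finset.univ_eq_empty,
      Finset.prod_empty, one_mul]
    rw [rpow_inv_rpow (hu _) h1κ.ne', sqrt_sq (hv _)]
  | succ n ih =>
    have hnn : ∀ a, 0 ≤ biasedExp p fun x : Fin n → Bool => u (Fin.cons a x) ^ (1 - κ)⁻¹ :=
      fun a => biasedExp_nonneg hp fun x => rpow_nonneg (hu _) _
    have hvn : ∀ b, 0 ≤ biasedExp p fun x : Fin n → Bool => v (Fin.cons b x) ^ 2 :=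
      fun b => biasedExp_nonneg hp fun x => sq_nonneg _
    have hop : ∀ a (x : Fin n → Bool), noiseOp p c v (Fin.cons a x) =
        ∑ b, bitNoise p c a b * noiseOp p c (fun y => v (Fin.cons b y)) x := by
      intro a x
      rw [noiseOp, sum_bool_cons]
      refine Finset.sum_congr rfl fun b _ => ?_
      rw [noiseOp, Finset.mul_sum]
      refine Finset.sum_congr rfl fun y _ => ?_
      rw [Fin.prod_univ_succ]
      simp [mul_assoc]
    have hstep : biasedExp p (fun x => u x * noiseOp p c v x) =
        ∑ a, ∑ b, bitMass p a * bitNoise p c a b * biasedExp p fun x =>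
          u (Fin.cons a x) * noiseOp p c (fun y => v (Fin.cons b y)) x := by
      rw [biasedExp_cons]
      refine Finset.sum_congr rfl fun a _ => ?_
      simp only [hop, biasedExp, Finset.mul_sum]
      rw [Finset.sum_comm]
      exact Finset.sum_congr rfl fun b _ => Finset.sum_congr rfl fun x _ => by ring
    rw [hstep, biasedExp_cons, biasedExp_cons]
    calc _ ≤ ∑ a, ∑ b, bitMass p a * bitNoise p c a b *
          ((biasedExp p fun x : Fin n → Bool => u (Fin.cons a x) ^ (1 - κ)⁻¹) ^ (1 - κ) *
          √(biasedExp p fun x : Fin n → Bool => v (Fin.cons b x) ^ 2)) := by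
          refine Finset.sum_le_sum fun a _ => Finset.sum_le_sum fun b _ => ?_
          exact mul_le_mul_of_nonneg_left (ih _ _ (fun _ => hu _) fun _ => hv _)
            (mul_nonneg (bitMass_nonneg hp a) (bitNoise_nonneg hp hc a b))
      _ ≤ _ := by
          have h := bit_noise_bilinear_le hp hp2 hκ hc hcκ
            (fun a => biasedExp p (fun x : Fin n → Bool => u (Fin.cons a x) ^ (1 - κ)⁻¹) ^ (1 - κ))
            (fun b => √(biasedExp p fun x : Fin n → Bool => v (Fin.cons b x) ^ 2))
            (fun a => rpow_nonneg (hnn a) _) fun b => sqrt_nonneg _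
          simpa only [rpow_rpow_inv (hnn _) h1κ.ne', sq_sqrt (hvn _)] using h

/-- Hypercontractivity from `L^{1/(1-κ)}` to `L²`, on the Fourier side. -/
theorem sum_pow_mul_biasedFourier_sq_le (hp : p ∈ Set.Ioo (0 : ℝ) 1) (hp2 : p ≠ 1 / 2)
    (hκ : κ ∈ Set.Ioo (0 : ℝ) 1) (hc : c ∈ Set.Icc (0 : ℝ) 1) (hcκ : c ^ 2 = κ / hyperconst p)
    (u : (Fin n → Bool) → ℝ) :
    ∑ S, (c ^ 2) ^ S.card * biasedFourier p u S ^ 2 ≤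
      (biasedExp p (fun x => |u x| ^ (1 - κ)⁻¹) ^ (1 - κ)) ^ 2 := by
  set N := biasedExp p (fun x => |u x| ^ (1 - κ)⁻¹) ^ (1 - κ) with hN
  have hN0 : 0 ≤ N := rpow_nonneg (biasedExp_nonneg hp fun x => rpow_nonneg (abs_nonneg _) _) _
  set v := noiseOp p c u with hv
  set Q := biasedExp p (fun x => v x ^ 2) with hQ
  have hQ0 : 0 ≤ Q := biasedExp_nonneg hp fun x => sq_nonneg _
  have h1 : ∑ S, (c ^ 2) ^ S.card * biasedFourier p u S ^ 2 = Q := by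
    simp only [hQ, sq (v _)]
    rw [← sum_biasedFourier_mul hp, hv]
    simp only [biasedFourier_noiseOp hp]
    exact Finset.sum_congr rfl fun S _ => by ring
  have h2 : Q = biasedExp p fun x => u x * noiseOp p c v x := by
    rw [← h1, ← sum_biasedFourier_mul hp, hv]
    simp only [biasedFourier_noiseOp hp]
    exact Finset.sum_congr rfl fun S _ => by ring
  -- Self-adjointness: `‖T u‖² = ⟨u, T (T u)⟩`, so the bilinear bound with `v = T u` has `‖T u‖` on
  -- the right, and one factor cancels.
  have h3 : Q ≤ N * √Q := by
    have h := noise_bilinear_le hp hp2 hκ hc hcκ (fun x => |u x|) (fun x => |v x|)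
      (fun x => abs_nonneg _) (fun x => abs_nonneg _)
    simp only [sq_abs] at h
    refine le_trans ?_ h
    rw [h2]
    refine Finset.sum_le_sum fun x _ => mul_le_mul_of_nonneg_left ?_ (biasedMass_nonneg hp x)
    refine (le_abs_self _).trans ?_
    rw [abs_mul]
    refine mul_le_mul_of_nonneg_left ?_ (abs_nonneg _)
    refine (Finset.abs_sum_le_sum_abs _ _).trans (Finset.sum_le_sum fun y _ => ?_)
    rw [abs_mul, abs_of_nonneg (Finset.prod_nonneg fun i _ => bitNoise_nonneg hp hc _ _)]
  rw [h1]
  rcases hQ0.eq_or_lt with h | h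
  · rw [← h]; positivity
  · have hs : 0 < √Q := sqrt_pos.2 h
    have : √Q ≤ N := by
      have h4 : √Q * √Q = Q := mul_self_sqrt hQ0
      by_contra hlt
      nlinarith
    calc Q = √Q ^ 2 := (sq_sqrt hQ0).symm
      _ ≤ N ^ 2 := by gcongr

/-- Log-convexity of norms: `1/(1-κ) = (1-τ)·1 + τ·2` with `τ = κ/(1-κ)`. -/
theorem norm_interpolation (hp : p ∈ Set.Ioo (0 : ℝ) 1) (hκ : κ ∈ Set.Ioo (0 : ℝ) (1 / 2))
    (u : (Fin n → Bool) → ℝ) :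
    (biasedExp p (fun x => |u x| ^ (1 - κ)⁻¹) ^ (1 - κ)) ^ 2 ≤
      (biasedExp p (fun x => |u x|) ^ 2) ^ (1 - 2 * κ) *
        biasedExp p (fun x => u x ^ 2) ^ (2 * κ) := by
  have h0 := hκ.1
  have h1κ : 0 < 1 - κ := by linarith [hκ.2]
  have hτ0 : 0 < κ / (1 - κ) := div_pos h0 h1κ
  have hτ1 : κ / (1 - κ) < 1 := by rw [div_lt_one h1κ]; linarith [hκ.2]
  have hE1 : 0 ≤ biasedExp p fun x => |u x| := biasedExp_nonneg hp fun x => abs_nonneg _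
  have hE2 : 0 ≤ biasedExp p fun x => u x ^ 2 := biasedExp_nonneg hp fun x => sq_nonneg _
  have h : biasedExp p (fun x => |u x| ^ (1 - κ)⁻¹) ≤
      biasedExp p (fun x => |u x|) ^ (1 - κ / (1 - κ)) *
        biasedExp p (fun x => u x ^ 2) ^ (κ / (1 - κ)) := by
    refine le_trans (le_of_eq ?_) (sum_mul_rpow_mul_rpow_le Finset.univ (biasedMass p)
      (fun x => |u x|) (fun x => u x ^ 2) (fun x _ => biasedMass_nonneg hp x)
      (fun x _ => abs_nonneg _) (fun x _ => sq_nonneg _) hτ0 hτ1)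
    refine Finset.sum_congr rfl fun x _ => ?_
    congr 1
    rw [← sq_abs, ← rpow_natCast |u x|, ← rpow_mul (abs_nonneg _),
      ← rpow_add' (abs_nonneg _)]
    · have he : 1 - κ / (1 - κ) + ((2 : ℕ) : ℝ) * (κ / (1 - κ)) = (1 - κ)⁻¹ := by
        push_cast; field_simp [h1κ.ne']; ring
      rw [he]
    · have : 1 - κ / (1 - κ) + ((2 : ℕ) : ℝ) * (κ / (1 - κ)) = 1 + κ / (1 - κ) := by
        push_cast; ring
      rw [this]; positivity
  have h2 := rpow_le_rpow (biasedExp_nonneg hp fun x => rpow_nonneg (abs_nonneg _) _) h h1κ.le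
  calc _ ≤ ((biasedExp p (fun x => |u x|) ^ (1 - κ / (1 - κ)) *
        biasedExp p (fun x => u x ^ 2) ^ (κ / (1 - κ))) ^ (1 - κ)) ^ 2 :=
        pow_le_pow_left₀ (rpow_nonneg (biasedExp_nonneg hp fun x =>
          rpow_nonneg (abs_nonneg _) _) _) h2 2
    _ = _ := by
        rw [mul_rpow (rpow_nonneg hE1 _) (rpow_nonneg hE2 _), ← rpow_mul hE1, ← rpow_mul hE2,
          mul_pow, ← rpow_natCast, ← rpow_natCast (_ ^ _), ← rpow_natCast (biasedExp p _),
          ← rpow_mul hE1, ← rpow_mul hE2, ← rpow_mul hE1]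
        congr 2
        · push_cast; field_simp; ring
        · push_cast; field_simp

end

/-! ### Entropy bounds edge correlations. -/

theorem two_mul_mul_div_add_le {A B : ℝ} (hA : 0 ≤ A) (hB : 0 ≤ B) :
    2 * (A * B / (A + B)) ≤ (A + B) * log (A + B) - A * log A - B * log B := by
  rcases hA.eq_or_lt with rfl | hA
  · simp
  rcases hB.eq_or_lt with rfl | hB
  · simp
  have hs : 0 < A + B := by positivity
  have h1 := log_le_sub_one_of_pos (div_pos hA hs)
  have h2 := log_le_sub_one_of_pos (div_pos hB hs)
  rw [log_div hA.ne' hs.ne'] at h1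
  rw [log_div hB.ne' hs.ne'] at h2
  have h3 := mul_le_mul_of_nonneg_left h1 hA.le
  have h4 := mul_le_mul_of_nonneg_left h2 hB.le
  have h5 : A * (A / (A + B) - 1) + B * (B / (A + B) - 1) = -(2 * (A * B / (A + B))) := by
    field_simp; ring
  linarith

theorem add_sq_le_add_mul_add {a b A B x y : ℝ} (hA : 0 ≤ A) (hB : 0 ≤ B) (hx : 0 ≤ x)
    (hy : 0 ≤ y) (ha : a ^ 2 ≤ A * x) (hb : b ^ 2 ≤ B * y) :
    (a + b) ^ 2 ≤ (A + B) * (x + y) := by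
  have h1 : (a * b) ^ 2 ≤ (A * y) * (B * x) := by
    calc (a * b) ^ 2 = a ^ 2 * b ^ 2 := by ring
      _ ≤ (A * x) * (B * y) := by gcongr
      _ = _ := by ring
  have h2 : 2 * (a * b) ≤ A * y + B * x := by
    refine le_of_abs_le (abs_le_of_sq_le_sq ?_ (by positivity))
    nlinarith [sq_nonneg (A * y - B * x)]
  nlinarith

/-- The sum over directions of the squared edge correlations of `c` is controlled by the entropy
of `c ^ 2`. -/
theorem exists_edge_bound {α : Type*} [DecidableEq α] (U : Finset α) (c : Finset α → ℝ) :
    ∃ φ : α → ℝ, (∀ i ∈ U, 0 ≤ φ i ∧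
      (∑ S ∈ (U.erase i).powerset, c S * c (insert i S)) ^ 2 ≤
        (∑ S ∈ U.powerset, c S ^ 2) * φ i) ∧
      2 * ∑ i ∈ U, φ i ≤ ∑ S ∈ U.powerset, negMulLog (c S ^ 2) +
        (∑ S ∈ U.powerset, c S ^ 2) * log (∑ S ∈ U.powerset, c S ^ 2) := by
  induction U using Finset.induction_on generalizing c with
  | empty => exact ⟨0, by simp, by simp [negMulLog]⟩
  | insert a V ha ih =>
    obtain ⟨φ, h1, h2⟩ := ih c
    obtain ⟨ψ, h3, h4⟩ := ih fun S => c (insert a S)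
    simp only [Finset.sum_powerset_insert ha]
    set A := ∑ S ∈ V.powerset, c S ^ 2 with hA
    set B := ∑ S ∈ V.powerset, c (insert a S) ^ 2 with hB
    have hA0 : 0 ≤ A := Finset.sum_nonneg fun _ _ => sq_nonneg _
    have hB0 : 0 ≤ B := Finset.sum_nonneg fun _ _ => sq_nonneg _
    -- Direction `a` joins the two halves: Cauchy–Schwarz bounds its squared correlation by `A * B`,
    -- and `two_mul_mul_div_add_le` pays for `A * B / (A + B)` out of the entropy of the split.
    -- Other directions add across the halves. If `A + B = 0` the quotient is `0`, as needed.
    refine ⟨fun i => if i = a then A * B / (A + B) else φ i + ψ i, ?_, ?_⟩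
    · intro i hi
      beta_reduce
      rcases Finset.mem_insert.1 hi with rfl | hi
      · rw [if_pos rfl, Finset.erase_insert ha]
        refine ⟨by positivity, ?_⟩
        have hcs : (∑ S ∈ V.powerset, c S * c (insert i S)) ^ 2 ≤ A * B :=
          Finset.sum_mul_sq_le_sq_mul_sq _ _ _
        rcases (add_nonneg hA0 hB0).eq_or_lt with h | h
        · have : A = 0 := by linarith
          simpa [this] using hcs
        · rwa [mul_div_cancel₀ _ h.ne']
      · have hia : i ≠ a := fun h => ha (h ▸ hi)
        rw [if_neg hia]
        obtain ⟨p1, q1⟩ := h1 i hi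
        obtain ⟨p2, q2⟩ := h3 i hi
        refine ⟨add_nonneg p1 p2, ?_⟩
        have ha' : a ∉ V.erase i := fun h => ha (Finset.mem_of_mem_erase h)
        rw [Finset.erase_insert_of_ne hia.symm, Finset.sum_powerset_insert ha']
        simp only [Finset.insert_comm i a]
        exact add_sq_le_add_mul_add hA0 hB0 p1 p2 q1 q2
    · rw [Finset.sum_insert ha, if_pos rfl]
      have : ∑ i ∈ V, (if i = a then A * B / (A + B) else φ i + ψ i) =
          ∑ i ∈ V, φ i + ∑ i ∈ V, ψ i := by
        rw [← Finset.sum_add_distrib (f := φ)]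
        refine Finset.sum_congr rfl fun i hi => if_neg ?_
        rintro rfl
        exact ha hi
      rw [this]
      have := two_mul_mul_div_add_le hA0 hB0
      linarith

theorem sum_sq_edge_le {n : ℕ} (c : Finset (Fin n) → ℝ) (hc : ∑ S, c S ^ 2 = 1) :
    2 * ∑ i, (∑ S ∈ (Finset.univ.erase i).powerset, c S * c (insert i S)) ^ 2 ≤
      ∑ S, c S ^ 2 * log (1 / c S ^ 2) := by
  obtain ⟨φ, h1, h2⟩ := exists_edge_bound Finset.univ c
  simp only [Finset.powerset_univ, hc, one_mul, log_one, add_zero] at h1 h2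
  have h3 : ∑ S, negMulLog (c S ^ 2) = ∑ S, c S ^ 2 * log (1 / c S ^ 2) :=
    Finset.sum_congr rfl fun S _ => by rw [one_div, log_inv, negMulLog]; ring
  rw [← h3]
  exact (mul_le_mul_of_nonneg_left
    (Finset.sum_le_sum fun i hi => (h1 i hi).2) zero_le_two).trans h2

/-! ### `L¹` influences as edge correlations. -/

section

variable {n : ℕ} {p : ℝ}

/-- For a Boolean function, the `L¹` norm of the derivative is a Fourier edge correlation. -/
theorem edge_eq_biasedExp_abs_deriv (hp : p ∈ Set.Ioo (0 : ℝ) 1) (f : (Fin n → Bool) → ℝ)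
    (hf : ∀ x, f x = 1 ∨ f x = -1) (i : Fin n) :
    ∑ S ∈ (Finset.univ.erase i).powerset, biasedFourier p f S * biasedFourier p f (insert i S) =
      (2 * p - 1) * biasedExp p fun x => |biasedDeriv p i f x| := by
  have h1 : ∑ S ∈ (Finset.univ.erase i).powerset,
      biasedFourier p f S * biasedFourier p f (insert i S) =
      ∑ S, biasedFourier p (biasedAvg p i f) S * biasedFourier p (biasedDeriv p i f) S := by
    rw [← Finset.sum_subset (Finset.subset_univ (Finset.univ.erase i).powerset)]
    · refine Finset.sum_congr rfl fun S hS => ?_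
      have hi : i ∉ S := fun h => by simpa using Finset.mem_powerset.1 hS h
      rw [biasedFourier_insert hp hi, biasedFourier_avg_of_notMem hi]
    · intro S _ hS
      have hi : i ∈ S := by
        by_contra hi
        exact hS (Finset.mem_powerset.2 fun j hj => by
          simpa using fun h : j = i => hi (h ▸ hj))
      rw [biasedFourier_deriv_of_mem hp hi, mul_zero]
  rw [h1, sum_biasedFourier_mul hp, biasedExp, biasedExp, Finset.mul_sum]
  refine Finset.sum_congr rfl fun x _ => ?_
  have hs := sqrt_bias_pos hp
  -- If the two values agree the derivative vanishes; otherwise the average is `2p-1` times the sign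
  -- of the derivative.
  have key : biasedAvg p i f x * biasedDeriv p i f x = (2 * p - 1) * |biasedDeriv p i f x| := by
    simp only [biasedAvg, biasedDeriv, abs_mul, abs_of_pos hs]
    rcases hf (Function.update x i true) with h | h <;>
      rcases hf (Function.update x i false) with h' | h' <;> rw [h, h']
    · simp
    · rw [show |(1 : ℝ) - -1| = 2 by norm_num]; ring
    · rw [show |(-1 : ℝ) - 1| = 2 by norm_num]; ring
    · simp
  rw [key]
  ring

end

/-! ### From influences to noise stability. -/

section

variable {n : ℕ} {p c κ ε : ℝ}

theorem sum_biasedFourier_deriv_sq (hp : p ∈ Set.Ioo (0 : ℝ) 1) (f : (Fin n → Bool) → ℝ) (t : ℝ) :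
    ∑ i, ∑ S, t ^ S.card * biasedFourier p (biasedDeriv p i f) S ^ 2 =
      ∑ S, S.card * t ^ (S.card - 1) * biasedFourier p f S ^ 2 := by
  have h : ∀ i, ∑ S, t ^ S.card * biasedFourier p (biasedDeriv p i f) S ^ 2 =
      ∑ S, if i ∈ S then t ^ (S.card - 1) * biasedFourier p f S ^ 2 else 0 := by
    intro i
    rw [← Finset.powerset_univ, ← Finset.insert_erase (Finset.mem_univ i),
      Finset.sum_powerset_insert (Finset.notMem_erase i _),
      Finset.sum_powerset_insert (Finset.notMem_erase i _), add_comm]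
    congr 1
    · rw [Finset.sum_eq_zero fun S _ => ?_, Finset.sum_eq_zero fun S hS => ?_]
      · exact if_neg fun h => by simpa using Finset.mem_powerset.1 hS h
      · rw [biasedFourier_deriv_of_mem hp (Finset.mem_insert_self i S)]; simp
    · refine Finset.sum_congr rfl fun S hS => ?_
      have hi : i ∉ S := fun h => by simpa using Finset.mem_powerset.1 hS h
      rw [if_pos (Finset.mem_insert_self i S), Finset.card_insert_of_notMem hi,
        biasedFourier_insert hp hi, Nat.add_sub_cancel]
  simp only [h]
  rw [Finset.sum_comm]
  refine Finset.sum_congr rfl fun S _ => ?_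
  rw [Finset.sum_ite_mem, Finset.univ_inter, Finset.sum_const, nsmul_eq_mul, mul_assoc]

theorem card_mul_pow_le (d : ℕ) : (d : ℝ) * (3 / 4) ^ (d - 1) ≤ 2 := by
  rcases d with _ | d
  · simp
  rw [Nat.add_sub_cancel]
  have h : ∀ d : ℕ, ((d : ℝ) + 4) * (3 / 4) ^ (d + 3) ≤ 2 := by
    intro d
    induction d with
    | zero => norm_num
    | succ d ih =>
      push_cast
      have : (0 : ℝ) < (3 / 4) ^ (d + 3) := by positivity
      rw [show d + 1 + 3 = (d + 3) + 1 by ring, pow_succ]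
      have hd : (0 : ℝ) ≤ d := Nat.cast_nonneg d
      nlinarith [mul_nonneg hd this.le]
  rcases d with _ | _ | _ | d
  · norm_num
  · norm_num
  · norm_num
  · have := h d
    push_cast
    linarith

theorem sum_biasedFourier_sq (hp : p ∈ Set.Ioo (0 : ℝ) 1) (f : (Fin n → Bool) → ℝ)
    (hf : ∀ x, f x = 1 ∨ f x = -1) : ∑ S, biasedFourier p f S ^ 2 = 1 := by
  simp only [sq]
  rw [sum_biasedFourier_mul hp, biasedExp, ← sum_biasedMass (n := n) (p := p)]
  refine Finset.sum_congr rfl fun x _ => ?_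
  rcases hf x with h | h <;> rw [h] <;> ring

theorem sum_sq_biasedExp_abs_deriv_le (hp : p ∈ Set.Ioo (0 : ℝ) 1) (hp2 : p ≠ 1 / 2)
    (f : (Fin n → Bool) → ℝ) (hf : ∀ x, f x = 1 ∨ f x = -1) :
    ∑ i, biasedExp p (fun x => |biasedDeriv p i f x|) ^ 2 ≤
      spectralEntropy p f / (2 * p - 1) ^ 2 / 2 := by
  have h := sum_sq_edge_le (biasedFourier p f) (sum_biasedFourier_sq hp f hf)
  simp only [edge_eq_biasedExp_abs_deriv hp f hf, mul_pow, ← Finset.mul_sum] at h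
  have h2 : 0 < (2 * p - 1) ^ 2 := by
    have : 2 * p - 1 ≠ 0 := fun h => hp2 (by linarith)
    positivity
  rw [div_div, le_div_iff₀ (by positivity)]
  calc _ = 2 * ((2 * p - 1) ^ 2 * ∑ i, biasedExp p (fun x => |biasedDeriv p i f x|) ^ 2) := by ring
    _ ≤ _ := h

/-- The factor `3/4` is noise set aside: smoothing each derivative by `s = √(3/4)` before
hypercontractivity keeps the total `L²` mass `∑ F i` at most `2`, whereas the total influence of `f`
may grow with `n`. `L¹` norms do not increase under smoothing. -/
theorem sum_card_mul_pow_le (hp : p ∈ Set.Ioo (0 : ℝ) 1) (hp2 : p ≠ 1 / 2)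
    (hκ : κ ∈ Set.Ioo (0 : ℝ) (1 / 2)) (hc : c ∈ Set.Icc (0 : ℝ) 1)
    (hcκ : c ^ 2 = κ / hyperconst p)
    (f : (Fin n → Bool) → ℝ) (hf : ∀ x, f x = 1 ∨ f x = -1) :
    ∑ S, S.card * (3 / 4 * c ^ 2) ^ (S.card - 1) * biasedFourier p f S ^ 2 ≤
      (spectralEntropy p f / (2 * p - 1) ^ 2 / 2) ^ (1 - 2 * κ) * 2 ^ (2 * κ) := by
  obtain ⟨s, hs⟩ : ∃ s, s = √(3 / 4 : ℝ) := ⟨_, rfl⟩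
  have hs2 : s ^ 2 = 3 / 4 := by rw [hs]; exact sq_sqrt (by norm_num)
  have hs01 : s ∈ Set.Icc (0 : ℝ) 1 := by
    rw [hs]; exact ⟨sqrt_nonneg _, sqrt_le_one.2 (by norm_num)⟩
  have hκ1 : κ ∈ Set.Ioo (0 : ℝ) 1 := ⟨hκ.1, by linarith [hκ.2]⟩
  have h12 : 0 < 1 - 2 * κ := by linarith [hκ.2]
  have h2κ : 0 < 2 * κ := by linarith [hκ.1]
  set E : Fin n → ℝ := fun i => biasedExp p fun x => |biasedDeriv p i f x| with hE
  set F : Fin n → ℝ := fun i => biasedExp p fun x => noiseOp p s (biasedDeriv p i f) x ^ 2 with hF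
  have hE0 : ∀ i, 0 ≤ E i := fun i => biasedExp_nonneg hp fun x => abs_nonneg _
  have hF0 : ∀ i, 0 ≤ F i := fun i => biasedExp_nonneg hp fun x => sq_nonneg _
  have hF1 : ∀ i, F i = ∑ S, (3 / 4) ^ S.card * biasedFourier p (biasedDeriv p i f) S ^ 2 := by
    intro i
    simp only [hF, sq (noiseOp _ _ _ _)]
    rw [← sum_biasedFourier_mul hp]
    simp only [biasedFourier_noiseOp hp, ← hs2]
    exact Finset.sum_congr rfl fun S _ => by ring
  have hFsum : ∑ i, F i ≤ 2 := by
    simp only [hF1]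
    rw [sum_biasedFourier_deriv_sq hp]
    calc _ ≤ ∑ S, 2 * biasedFourier p f S ^ 2 :=
          Finset.sum_le_sum fun S _ =>
            mul_le_mul_of_nonneg_right (card_mul_pow_le _) (sq_nonneg _)
      _ = 2 := by rw [← Finset.mul_sum, sum_biasedFourier_sq hp f hf, mul_one]
  rw [← sum_biasedFourier_deriv_sq hp]
  have hi : ∀ i, ∑ S, (3 / 4 * c ^ 2) ^ S.card * biasedFourier p (biasedDeriv p i f) S ^ 2 ≤
      (E i ^ 2) ^ (1 - 2 * κ) * F i ^ (2 * κ) := by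
    intro i
    have h1 := sum_pow_mul_biasedFourier_sq_le hp hp2 hκ1 hc hcκ (noiseOp p s (biasedDeriv p i f))
    have h2 := norm_interpolation hp hκ (noiseOp p s (biasedDeriv p i f))
    have h3 := biasedExp_abs_noiseOp_le hp hs01 (biasedDeriv p i f)
    calc _ = ∑ S, (c ^ 2) ^ S.card * biasedFourier p (noiseOp p s (biasedDeriv p i f)) S ^ 2 := by
          refine Finset.sum_congr rfl fun S _ => ?_
          rw [biasedFourier_noiseOp hp, ← hs2]; ring
      _ ≤ _ := h1.trans h2
      _ ≤ _ := by
          refine mul_le_mul_of_nonneg_right ?_ (rpow_nonneg (hF0 i) _)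
          refine rpow_le_rpow (sq_nonneg _) ?_ h12.le
          exact pow_le_pow_left₀ (biasedExp_nonneg hp fun x => abs_nonneg _) h3 2
  calc _ ≤ ∑ i, 1 * ((E i ^ 2) ^ (1 - 2 * κ) * F i ^ (2 * κ)) :=
        Finset.sum_le_sum fun i _ => by rw [one_mul]; exact hi i
    _ ≤ (∑ i, 1 * E i ^ 2) ^ (1 - 2 * κ) * (∑ i, 1 * F i) ^ (2 * κ) :=
        sum_mul_rpow_mul_rpow_le _ _ _ _ (fun _ _ => zero_le_one) (fun i _ => sq_nonneg _)
          (fun i _ => hF0 i) h2κ (by linarith)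
    _ ≤ _ := by
        simp only [one_mul]
        have h1 : 0 ≤ ∑ i, E i ^ 2 := Finset.sum_nonneg fun i _ => sq_nonneg _
        have h2 := sum_sq_biasedExp_abs_deriv_le hp hp2 f hf
        exact mul_le_mul (rpow_le_rpow h1 h2 h12.le)
          (rpow_le_rpow (Finset.sum_nonneg fun i _ => hF0 i) hFsum h2κ.le)
          (rpow_nonneg (Finset.sum_nonneg fun i _ => hF0 i) _) (rpow_nonneg (h1.trans h2) _)

theorem noiseStability_eq (hp : p ∈ Set.Ioo (0 : ℝ) 1) (ε : ℝ) (f : (Fin n → Bool) → ℝ) :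
    noiseStability p ε f =
      ∑ S ∈ Finset.univ.erase ∅, biasedFourier p f S ^ 2 * (1 - ε) ^ S.card := by
  have h0 : biasedFourier p f ∅ = biasedExp p f := by simp [biasedFourier, biasedChar]
  rw [noiseStability, noiseCorrelation_eq, ← sum_biasedFourier_mul hp, ← h0,
    ← Finset.add_sum_erase _ _ (Finset.mem_univ ∅)]
  simp only [biasedFourier_noiseOp hp, Finset.card_empty, pow_zero, one_mul, add_sub_cancel_left]
  exact Finset.sum_congr rfl fun S _ => by ring

theorem low_noise_sum_le (hp : p ∈ Set.Ioo (0 : ℝ) 1) (hp2 : p ≠ 1 / 2)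
    (hκ : κ ∈ Set.Ioo (0 : ℝ) (1 / 2))
    (f : (Fin n → Bool) → ℝ) (hf : ∀ x, f x = 1 ∨ f x = -1) :
    ∑ S ∈ Finset.univ.erase ∅, biasedFourier p f S ^ 2 *
        (3 / 4 * (κ / hyperconst p)) ^ S.card ≤
      (spectralEntropy p f / (2 * p - 1) ^ 2) ^ (1 - 2 * κ) := by
  have hB := one_le_hyperconst hp hp2
  have hκ0 := hκ.1
  have h0 : 0 ≤ κ / hyperconst p := by positivity
  have h1 : κ / hyperconst p ≤ 1 / 2 := (div_le_self hκ0.le hB).trans hκ.2.le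
  obtain ⟨c, hc⟩ : ∃ c, c = √(κ / hyperconst p) := ⟨_, rfl⟩
  have hc2 : c ^ 2 = κ / hyperconst p := by rw [hc, sq_sqrt h0]
  have hc01 : c ∈ Set.Icc (0 : ℝ) 1 := by
    rw [hc]; exact ⟨sqrt_nonneg _, sqrt_le_one.2 (by linarith)⟩
  have h := sum_card_mul_pow_le hp hp2 hκ hc01 hc2 f hf
  rw [hc2] at h
  set r := 3 / 4 * (κ / hyperconst p) with hr
  have hr0 : 0 ≤ r := by positivity
  have hr1 : r ≤ 1 / 2 := by rw [hr]; linarith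
  have hw : 0 ≤ spectralEntropy p f / (2 * p - 1) ^ 2 := by
    have h2 : 0 ≤ ∑ i, biasedExp p (fun x => |biasedDeriv p i f x|) ^ 2 :=
      Finset.sum_nonneg fun i _ => sq_nonneg _
    linarith [sum_sq_biasedExp_abs_deriv_le hp hp2 f hf]
  set w := spectralEntropy p f / (2 * p - 1) ^ 2 with hw'
  calc _ ≤ ∑ S ∈ Finset.univ.erase ∅, r * (S.card * r ^ (S.card - 1) * biasedFourier p f S ^ 2) := by
        refine Finset.sum_le_sum fun S hS => ?_
        have hS : S.Nonempty := Finset.nonempty_iff_ne_empty.2 (Finset.ne_of_mem_erase hS)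
        have hcard : 1 ≤ S.card := hS.card_pos
        have hcard' : (1 : ℝ) ≤ S.card := by exact_mod_cast hcard
        have e : r ^ S.card = r * r ^ (S.card - 1) := by
          rw [← pow_succ', Nat.sub_add_cancel hcard]
        have h3 : 0 ≤ biasedFourier p f S ^ 2 * r ^ S.card := by positivity
        calc _ ≤ S.card * (biasedFourier p f S ^ 2 * r ^ S.card) := le_mul_of_one_le_left h3 hcard'
          _ = _ := by rw [e]; ring
    _ ≤ ∑ S, r * (S.card * r ^ (S.card - 1) * biasedFourier p f S ^ 2) :=
        Finset.sum_le_sum_of_subset_of_nonneg (Finset.erase_subset _ _)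
          fun S _ _ => by positivity
    _ = r * ∑ S, S.card * r ^ (S.card - 1) * biasedFourier p f S ^ 2 := by rw [Finset.mul_sum]
    -- Here `r ≤ 1/2` pays for the crude bound `2 ^ (2κ) ≤ 2` of the next step, so no constant
    -- remains.
    _ ≤ 1 / 2 * ((w / 2) ^ (1 - 2 * κ) * 2 ^ (2 * κ)) := by
        refine mul_le_mul hr1 h (Finset.sum_nonneg fun S _ => by positivity) (by norm_num)
    _ ≤ 1 / 2 * (w ^ (1 - 2 * κ) * 2 ^ (1 : ℝ)) := by
        have h12 : 0 ≤ 1 - 2 * κ := by linarith [hκ.2]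
        gcongr
        · linarith
        · norm_num
        · linarith [hκ.2]
    _ = _ := by rw [rpow_one]; ring

/-- The left side is `log (1/r)` for the chosen `κ`. Its `2 log L` comes from `1/κ = 2L^2`; the
third `log L` and the slack in the constants absorb the loss `1 - 1/L^2`. The threshold `1.69` lies
just below `1 + log 2`. -/
theorem exponent_bound {L : ℝ} (hL : 1.69 ≤ L) :
    log (4 / 3) + (L - 1) + 2 * log L ≤ (1 - 1 / L ^ 2) * (L + 3 * log L) := by
  have hL0 : 0 < L := by linarith
  have h1 : log (4 / 3) ≤ 1 / 3 := by
    have := log_le_sub_one_of_pos (show (0 : ℝ) < 4 / 3 by norm_num)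
    linarith
  have hl0 : 0 ≤ log L := log_nonneg (by linarith)
  have hl1 : log L ≤ L - 1 := log_le_sub_one_of_pos hL0
  have hy : 1 / L ≤ 1 / 1.69 := one_div_le_one_div_of_le (by norm_num) hL
  have hy0 : 0 < 1 / L := by positivity
  obtain ⟨y, hyL⟩ : ∃ y, y = 1 / L := ⟨_, rfl⟩
  rw [← hyL] at hy hy0
  have e : (1 - 1 / L ^ 2) * (L + 3 * log L) =
      L + 3 * log L - y - 3 * y ^ 2 * log L := by rw [hyL]; field_simp; ring
  rw [e]
  suffices log L * (3 * y ^ 2 - 1) ≤ 2 / 3 - y by linarith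
  have hy2 : 3 * y ^ 2 - 1 ≤ 0.051 := by
    have : y ^ 2 ≤ (1 / 1.69) ^ 2 := by gcongr
    norm_num at this ⊢
    linarith
  have hy3 : y ≤ 0.592 := hy.trans (by norm_num)
  rcases le_total (3 * y ^ 2 - 1) 0 with h | h
  · have := mul_nonneg hl0 (neg_nonneg.2 h)
    linarith
  · have hLy : L * y = 1 := by rw [hyL]; field_simp
    have hL2 : L ≤ 1.8 := by
      by_contra hlt
      nlinarith
    calc log L * (3 * y ^ 2 - 1) ≤ 0.8 * 0.051 :=
          mul_le_mul (by linarith) hy2 h (by norm_num)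
      _ ≤ 2 / 3 - y := by norm_num at hy3 ⊢; linarith

end

theorem corollary2 (n : ℕ) (p ε : ℝ) (hp : p ∈ Set.Ioo (0 : ℝ) 1) (hp2 : p ≠ 1 / 2)
    (hε : ε ∈ Set.Ioo (0 : ℝ) 1) (f : (Fin n → Bool) → ℝ) (hf : ∀ x, f x = 1 ∨ f x = -1) :
    noiseStability p ε f ≤
      (6 * Real.exp 1 + 1) *
        (spectralEntropy p f / (2 * p - 1) ^ 2) ^ (kellerKindlerExponent p ε * ε) := by
  have hB := one_le_hyperconst hp hp2
  have hB0 : 0 < hyperconst p := by linarith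
  obtain ⟨L, hL⟩ : ∃ L, L = log (2 * exp 1 * hyperconst p) := ⟨_, rfl⟩
  have hL' : L = 1 + log (2 * hyperconst p) := by
    rw [hL, show 2 * exp 1 * hyperconst p = exp 1 * (2 * hyperconst p) by ring,
      log_mul (exp_pos 1).ne' (by positivity), log_exp]
  have hL1 : 1.69 ≤ L := by
    have h1 : log 2 ≤ log (2 * hyperconst p) := log_le_log two_pos (by linarith)
    have h2 := log_two_gt_d9
    rw [hL']
    norm_num at h2 ⊢
    linarith
  have hL0 : 0 < L := by linarith
  have hlL : 0 < log L := log_pos (by linarith)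
  have hα : kellerKindlerExponent p ε = 1 / (ε + L + 3 * log L) := by
    rw [kellerKindlerExponent, ← hL]
  have hden : 0 < ε + L + 3 * log L := by linarith [hε.1]
  have hαε : 0 < kellerKindlerExponent p ε * ε := by
    rw [hα]; exact mul_pos (by positivity) hε.1
  -- A balance: smaller `κ` improves the power `1-2κ` but lowers `r`; this choice costs `2 log L` in
  -- `log (1/r)`.
  obtain ⟨κ, hκ⟩ : ∃ κ, κ = 1 / (2 * L ^ 2) := ⟨_, rfl⟩
  have hκ' : κ ∈ Set.Ioo (0 : ℝ) (1 / 2) := by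
    rw [hκ]
    refine ⟨by positivity, one_div_lt_one_div_of_lt two_pos ?_⟩
    nlinarith
  have hκ2 : 2 * κ = 1 / L ^ 2 := by rw [hκ]; field_simp
  have hlow := low_noise_sum_le hp hp2 hκ' f hf
  have hw : 0 ≤ spectralEntropy p f / (2 * p - 1) ^ 2 := by
    have h2 : 0 ≤ ∑ i, biasedExp p (fun x => |biasedDeriv p i f x|) ^ 2 :=
      Finset.sum_nonneg fun i _ => sq_nonneg _
    linarith [sum_sq_biasedExp_abs_deriv_le hp hp2 f hf]
  set w := spectralEntropy p f / (2 * p - 1) ^ 2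
  obtain ⟨r, hr⟩ : ∃ r, r = 3 / 4 * (κ / hyperconst p) := ⟨_, rfl⟩
  have hr0 : 0 < r := by have := hκ'.1; rw [hr]; positivity
  rw [← hr] at hlow
  have hrinv : r⁻¹ = 4 / 3 * (2 * hyperconst p) * L ^ 2 := by
    rw [hr, hκ]; field_simp
  obtain ⟨Λ, hΛ⟩ : ∃ Λ, Λ = -log r := ⟨_, rfl⟩
  have hΛ' : Λ = log (4 / 3) + (L - 1) + 2 * log L := by
    rw [hΛ, ← log_inv, hrinv, log_mul (by positivity) (by positivity),
      log_mul (by norm_num) (by positivity), log_pow, hL']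
    push_cast; ring
  have hΛ1 : 1 ≤ Λ := by
    rw [hΛ, ← log_inv, le_log_iff_exp_le (inv_pos.2 hr0), hrinv]
    have := exp_one_lt_d9
    have h2 : 1.5 ≤ L ^ 2 := by nlinarith
    calc exp 1 ≤ 4 / 3 * (2 * 1) * 1.5 := by norm_num at this ⊢; linarith
      _ ≤ _ := by gcongr
  have hΛ0 : 0 < Λ := by linarith
  -- Chosen so that `r ^ θ = exp (-ε) ≥ 1 - ε`.
  obtain ⟨θ, hθ⟩ : ∃ θ, θ = ε / Λ := ⟨_, rfl⟩
  have hθ0 : 0 < θ := by rw [hθ]; exact div_pos hε.1 hΛ0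
  have hθ1 : θ < 1 := by rw [hθ, div_lt_one hΛ0]; linarith [hε.2]
  have hrθ : 1 - ε ≤ r ^ θ := by
    rw [rpow_def_of_pos hr0, show log r * θ = -ε by
      rw [hθ, show log r = -Λ by rw [hΛ]; ring]; field_simp]
    exact one_sub_le_exp_neg ε
  have htot : ∑ S ∈ Finset.univ.erase ∅, biasedFourier p f S ^ 2 * 1 ≤ 1 := by
    simp only [mul_one]
    rw [← sum_biasedFourier_sq hp f hf]
    exact Finset.sum_le_sum_of_subset_of_nonneg (Finset.erase_subset _ _)
      fun S _ _ => sq_nonneg _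
  have h1ε : 0 ≤ 1 - ε := by linarith [hε.2]
  rw [noiseStability_eq hp]
  have hmain : ∑ S ∈ Finset.univ.erase ∅, biasedFourier p f S ^ 2 * (1 - ε) ^ S.card ≤
      w ^ (kellerKindlerExponent p ε * ε) := by
    -- For `w ≥ 1` the total Fourier mass `1` suffices; for `w ≤ 1` lowering the exponent only
    -- enlarges the power.
    rcases le_total 1 w with h1 | h1
    · refine le_trans ?_ (one_le_rpow h1 hαε.le)
      refine le_trans (Finset.sum_le_sum fun S _ => ?_) htot
      exact mul_le_mul_of_nonneg_left (pow_le_one₀ h1ε (by linarith [hε.1])) (sq_nonneg _)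
    · have hexp : kellerKindlerExponent p ε * ε ≤ (1 - 2 * κ) * θ := by
        have hb := exponent_bound hL1
        rw [← hΛ', ← hκ2] at hb
        rw [hα, hθ, ← mul_div_assoc, one_div, inv_mul_eq_div]
        rw [div_le_div_iff₀ hden hΛ0]
        have h3 : 0 ≤ 1 - 2 * κ := by linarith [hκ'.2]
        have h4 : Λ ≤ (1 - 2 * κ) * (ε + L + 3 * log L) := by
          have := mul_nonneg h3 hε.1.le
          linarith
        calc ε * Λ ≤ ε * ((1 - 2 * κ) * (ε + L + 3 * log L)) :=
              mul_le_mul_of_nonneg_left h4 hε.1.le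
          _ = _ := by ring
      calc _ ≤ ∑ S ∈ Finset.univ.erase ∅, biasedFourier p f S ^ 2 *
            ((1 : ℝ) ^ (1 - θ) * (r ^ S.card) ^ θ) := by
            refine Finset.sum_le_sum fun S _ => mul_le_mul_of_nonneg_left ?_ (sq_nonneg _)
            rw [one_rpow, one_mul, ← rpow_natCast r, ← rpow_mul hr0.le, mul_comm _ θ,
              rpow_mul hr0.le, rpow_natCast]
            exact pow_le_pow_left₀ h1ε hrθ _
        _ ≤ (∑ S ∈ Finset.univ.erase ∅, biasedFourier p f S ^ 2 * 1) ^ (1 - θ) *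
            (∑ S ∈ Finset.univ.erase ∅, biasedFourier p f S ^ 2 * r ^ S.card) ^ θ := by
            exact sum_mul_rpow_mul_rpow_le (Finset.univ.erase ∅)
              (fun S => biasedFourier p f S ^ 2) (fun _ => 1) (fun S => r ^ S.card)
              (fun S _ => sq_nonneg _) (fun _ _ => zero_le_one) (fun S _ => by positivity) hθ0 hθ1
        _ ≤ 1 * (w ^ (1 - 2 * κ)) ^ θ := by
            have h3 : 0 ≤ ∑ S ∈ Finset.univ.erase ∅, biasedFourier p f S ^ 2 * 1 :=
              Finset.sum_nonneg fun S _ => by positivity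
            have h4 : 0 ≤ ∑ S ∈ Finset.univ.erase ∅, biasedFourier p f S ^ 2 * r ^ S.card :=
              Finset.sum_nonneg fun S _ => by positivity
            exact mul_le_mul (rpow_le_one h3 htot (by linarith)) (rpow_le_rpow h4 hlow hθ0.le)
              (rpow_nonneg h4 _) zero_le_one
        _ = w ^ ((1 - 2 * κ) * θ) := by rw [one_mul, rpow_mul hw]
        _ ≤ _ := rpow_le_rpow_of_exponent_ge' hw h1 hαε.le hexp
  -- The bound already holds with constant `1`.
  refine hmain.trans (le_mul_of_one_le_left (rpow_nonneg hw _) ?_)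
  linarith [exp_pos 1]
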